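/- Work in $\mathbb R^{1+2}$ with points $(t,x)$, $x=(x_1,x_2)$, $r=|x|$. Let $\mathcal H_s=\{(t,x): t^2=|x|^2+s^2\}$, let $L_a=x_a\partial_t+t\partial_a$ ($a=1,2$) be the Lorentz boosts, let $L^J=L_1^{J_1}L_2^{J_2}$ and $|J|=J_1+J_2$ for a multi-index $J=(J_1,J_2)\in\mathbb N^2$ (with $0\in\mathbb N$), and put $$\|\phi\|_{L^2_f(\mathcal H_s)}=\Big(\int_{\mathbb R^2}\big|\phi\big(\sqrt{s^2+|x|^2},x\big)\big|^2\,dx\Big)^{1/2}.$$ (i) There is a constant $C$ such that for every $s\ge 2$ and every real-valued $u\in C^2(\mathbb R^{1+2})$ supported in $\{(t,x):|x|\le t-1\}$, $$\sup_{\mathcal H_s}|s\,u|\le C\sum_{|J|\le 2}\big\|(s/t)\,L^Ju\big\|_{L^2_f(\mathcal H_s)}.$$ (ii) For every $\gamma\in\mathbb R$ there is a constant $C_\gamma$, depending only on $\gamma$, such that for every $s\ge 2$ and every real-valued $u\in C^2(\mathbb R^{1+2})$ supported in $\{(t,x):|x|\le t-1\}$, $$\sup_{\mathcal H_s}\big|s\,(t-r)^{-\gamma}u\big|\le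 C_\gamma\sum_{|J|\le 2}\big\|(s/t)(t-r)^{-\gamma}L^Ju\big\|_{L^2_f(\mathcal H_s)}.$$ (At points where $u=0$ the quantity $|s(t-r)^{-\gamma}u|$ is taken to be $0$.) -/

import Mathlib

open MeasureTheory
open scoped NNReal ENNReal

/-- The `(1+2)`-dimensional spacetime; a point is `(t, x)` with `x` in the Euclidean plane. -/
abbrev Spacetime : Type := ℝ × EuclideanSpace ℝ (Fin 2)

namespace Spacetime

/-- The solid cone `{(t, x) : |x| ≤ t - 1}`. -/
def cone : Set Spacetime := {p | ‖p.2‖ ≤ p.1 - 1}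

/-- The hyperboloid `{(t, x) : t² = |x|² + s²}` of hyperbolic time `s`. -/
def hyperboloid (s : ℝ) : Set Spacetime := {p | p.1 ^ 2 = ‖p.2‖ ^ 2 + s ^ 2}

/-- The time derivative `∂_t u`. -/
noncomputable def dt (u : Spacetime → ℝ) : Spacetime → ℝ :=
  fun p => fderiv ℝ u p (1, 0)

/-- The space derivative `∂_a u`. -/
noncomputable def dx (a : Fin 2) (u : Spacetime → ℝ) : Spacetime → ℝ :=
  fun p => fderiv ℝ u p (0, EuclideanSpace.single a 1)

/-- The Lorentz boost `L_a u = x_a ∂_t u + t ∂_a u`. -/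
noncomputable def boost (a : Fin 2) (u : Spacetime → ℝ) : Spacetime → ℝ :=
  fun p => p.2 a * dt u p + p.1 * dx a u p

/-- For a multi-index `J = (J₁, J₂)`, the operator `L^J = L₁^{J₁} L₂^{J₂}`
(the indices `1, 2` are `0, 1 : Fin 2` here). -/
noncomputable def boostPow (J : Fin 2 → ℕ) (u : Spacetime → ℝ) : Spacetime → ℝ :=
  (boost 0)^[J 0] ((boost 1)^[J 1] u)

/-- The finite set of the multi-indices `J ∈ ℕ²` with `|J| = J₁ + J₂ ≤ k`. -/
def multiIndices (k : ℕ) : Finset (Fin 2 → ℕ) :=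
  (Fintype.piFinset fun _ : Fin 2 => Finset.range (k + 1)).filter fun J => J 0 + J 1 ≤ k

/-- The norm `‖φ‖_{L²_f(H_s)} = (∫_{ℝ²} |φ(√(s² + |x|²), x)|² dx)^{1/2}`, valued in `[0, ∞]`:
the hyperboloid carries the flat measure `dx`. -/
noncomputable def l2f (s : ℝ) (φ : Spacetime → ℝ) : ℝ≥0∞ :=
  (∫⁻ x : EuclideanSpace ℝ (Fin 2), ‖φ (√(s ^ 2 + ‖x‖ ^ 2), x)‖ₑ ^ 2) ^ (1 / 2 : ℝ)

end Spacetime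

/-! In the coordinates `x` on `H_s`, the derivative `∂_a` of a restricted function is `L_a/t`
(`hasDerivAt_comp_lift`). At a point with time `t₀`, take the square with corner `x₀` and side `h =
t₀/4`. There `t` is comparable to `h`, so `h ∂_a` is a boost with a bounded coefficient. Integrating
along each axis bounds `h² |u(x₀)|` by the integral over the square of `u` and its scaled first and
mixed derivatives (`enorm_le_lintegral_square`). Cauchy–Schwarz on area `h²` costs one factor `h`
(`setLIntegral_square_le`), and writing `s = (s/t) t` with `t ≤ 8h` supplies the other.

The weight is never differentiated: since `(t - r)(t + r) = s²`, it varies by at most `4^|γ|` on the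
square (`weight_le`). The unweighted bound is `γ = 0`. -/

namespace Spacetime

/-- The lift of a point of the plane to the upper sheet of the hyperboloid `H_s`. -/
noncomputable def lift (s : ℝ) (x : EuclideanSpace ℝ (Fin 2)) : Spacetime :=
  (√(s ^ 2 + ‖x‖ ^ 2), x)

lemma continuous_lift (s : ℝ) : Continuous (lift s) := by
  unfold lift; fun_prop

lemma lift_fst_pos {s : ℝ} (hs : 0 < s) (x : EuclideanSpace ℝ (Fin 2)) : 0 < (lift s x).1 :=
  Real.sqrt_pos.2 (by positivity)

lemma lift_fst_sq (s : ℝ) (x : EuclideanSpace ℝ (Fin 2)) :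
    (lift s x).1 ^ 2 = s ^ 2 + ‖x‖ ^ 2 :=
  Real.sq_sqrt (by positivity)

lemma norm_lt_lift_fst {s : ℝ} (hs : 0 < s) (x : EuclideanSpace ℝ (Fin 2)) :
    ‖x‖ < (lift s x).1 := by
  have := lift_fst_sq s x
  exact lt_of_pow_lt_pow_left₀ 2 (lift_fst_pos hs x).le (by nlinarith)

/-- `√(s² + |x|²)` is the Euclidean norm of `(s, x)`, hence 1-Lipschitz in `x`. -/
lemma lift_fst_le_add {s : ℝ} (hs : 0 < s) (x y : EuclideanSpace ℝ (Fin 2)) :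
    (lift s x).1 ≤ (lift s y).1 + ‖x - y‖ := by
  have hx := lift_fst_sq s x
  have hy := lift_fst_sq s y
  have hlt := norm_lt_lift_fst hs y
  have htri : ‖x‖ ≤ ‖y‖ + ‖x - y‖ := norm_le_norm_add_norm_sub' x y
  have hd := norm_nonneg (x - y)
  have hn := norm_nonneg x
  refine le_of_sq_le_sq ?_ (add_nonneg (lift_fst_pos hs y).le hd)
  nlinarith [mul_le_mul_of_nonneg_right hlt.le hd]

/-! ### Boosts are tangent to the hyperboloids -/

lemma hasDerivAt_lift_fst {s : ℝ} (hs : 0 < s) {x : ℝ → EuclideanSpace ℝ (Fin 2)} {i : Fin 2}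
    {a : ℝ} (hx : HasDerivAt x (EuclideanSpace.single i 1) a) :
    HasDerivAt (fun τ => (lift s (x τ)).1) (x a i / (lift s (x a)).1) a := by
  have h := (hx.norm_sq.const_add (s ^ 2)).sqrt (by positivity)
  refine h.congr_deriv ?_
  rw [EuclideanSpace.inner_single_right, mul_div_mul_left _ _ two_ne_zero, conj_trivial, one_mul]
  rfl

/-- The tangent vector of the lifted curve is `(x_i/t, e_i)`, which is `L_i` divided by `t`. -/
lemma hasDerivAt_comp_lift {s : ℝ} (hs : 0 < s) {w : Spacetime → ℝ} (hw : ContDiff ℝ 1 w)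
    {x : ℝ → EuclideanSpace ℝ (Fin 2)} {i : Fin 2}
    {a : ℝ} (hx : HasDerivAt x (EuclideanSpace.single i 1) a) :
    HasDerivAt (fun τ => w (lift s (x τ)))
      (boost i w (lift s (x a)) / (lift s (x a)).1) a := by
  have hΦ : HasDerivAt (fun τ => lift s (x τ))
      (x a i / (lift s (x a)).1, EuclideanSpace.single i 1) a :=
    (hasDerivAt_lift_fst hs hx).prodMk hx
  have h := ((hw.differentiable one_ne_zero) (lift s (x a))).hasFDerivAt.comp_hasDerivAt a hΦ
  refine h.congr_deriv ?_
  have hsplit : ((x a i / (lift s (x a)).1, EuclideanSpace.single i 1) : Spacetime) =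
      (x a i / (lift s (x a)).1) • ((1, 0) : Spacetime) + (0, EuclideanSpace.single i 1) := by
    ext <;> simp
  rw [hsplit, map_add, map_smul]
  have := (lift_fst_pos hs (x a)).ne'
  simp only [boost, dt, dx, smul_eq_mul]
  field_simp
  exact congrArg (· + _) (mul_comm _ _)

lemma contDiff_boost {m n : WithTop ℕ∞} {u : Spacetime → ℝ} (hu : ContDiff ℝ n u)
    (h : m + 1 ≤ n) (i : Fin 2) : ContDiff ℝ m (boost i u) := by
  have hf : ContDiff ℝ m (fderiv ℝ u) := hu.fderiv_right h
  have hp : ContDiff ℝ m (fun p : Spacetime => p.2 i) :=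
    (EuclideanSpace.proj (𝕜 := ℝ) i).contDiff.comp contDiff_snd
  exact (hp.mul (hf.clm_apply contDiff_const)).add (contDiff_fst.mul (hf.clm_apply contDiff_const))

/-! ### A Sobolev inequality on squares -/

/-- Average `|f a| ≤ |f y| + ∫ |f'|` over `y` in the interval. -/
lemma enorm_le_lintegral_deriv {f f' : ℝ → ℝ} (hf : ∀ x, HasDerivAt f (f' x) x)
    (hf' : Continuous f') (a h : ℝ) :
    ENNReal.ofReal h * ‖f a‖ₑ ≤
      ∫⁻ y in Set.Icc a (a + h), (‖f y‖ₑ + ENNReal.ofReal h * ‖f' y‖ₑ) := by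
  have hc : Continuous f := continuous_iff_continuousAt.2 fun x => (hf x).continuousAt
  have key : ∀ y ∈ Set.Icc a (a + h), ‖f a‖ₑ ≤
      ‖f y‖ₑ + ∫⁻ z in Set.Icc a (a + h), ‖f' z‖ₑ := by
    intro y hy
    have hint : ∫ z in Set.Ioc a y, f' z = f y - f a := by
      rw [← intervalIntegral.integral_of_le hy.1]
      exact intervalIntegral.integral_eq_sub_of_hasDerivAt (fun x _ => hf x)
        (hf'.intervalIntegrable _ _)
    have h1 : ‖f y - f a‖ₑ ≤ ∫⁻ z in Set.Icc a (a + h), ‖f' z‖ₑ := by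
      rw [← hint]
      exact (enorm_integral_le_lintegral_enorm _).trans (lintegral_mono_set
        (Set.Ioc_subset_Icc_self.trans (Set.Icc_subset_Icc_right hy.2)))
    calc ‖f a‖ₑ = ‖f y - (f y - f a)‖ₑ := by rw [sub_sub_cancel]
      _ ≤ ‖f y‖ₑ + ‖f y - f a‖ₑ := enorm_sub_le
      _ ≤ _ := by gcongr
  have hvol : volume (Set.Icc a (a + h)) = ENNReal.ofReal h := by simp
  calc ENNReal.ofReal h * ‖f a‖ₑ = ∫⁻ _ in Set.Icc a (a + h), ‖f a‖ₑ := by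
        rw [setLIntegral_const, hvol, mul_comm]
    _ ≤ ∫⁻ y in Set.Icc a (a + h), (‖f y‖ₑ + ∫⁻ z in Set.Icc a (a + h), ‖f' z‖ₑ) :=
        setLIntegral_mono' measurableSet_Icc key
    _ = _ := by
        rw [lintegral_add_left (by fun_prop), setLIntegral_const, hvol,
          lintegral_add_left (by fun_prop), lintegral_const_mul _ (by fun_prop), mul_comm]

/-- The one-dimensional bound is used in the second variable, then in the first for both `F` and
`F₂`; so only the mixed second derivative enters. -/
lemma enorm_le_lintegral_square {F F₁ F₂ F₁₂ : ℝ × ℝ → ℝ}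
    (h₁ : ∀ a b, HasDerivAt (fun τ => F (τ, b)) (F₁ (a, b)) a)
    (h₂ : ∀ a b, HasDerivAt (fun τ => F (a, τ)) (F₂ (a, b)) b)
    (h₁₂ : ∀ a b, HasDerivAt (fun τ => F₂ (τ, b)) (F₁₂ (a, b)) a)
    (hF : Continuous F) (hF₁ : Continuous F₁) (hF₂ : Continuous F₂) (hF₁₂ : Continuous F₁₂)
    (a b h : ℝ) :
    ENNReal.ofReal h ^ 2 * ‖F (a, b)‖ₑ ≤
      ∫⁻ p in Set.Icc a (a + h) ×ˢ Set.Icc b (b + h), (‖F p‖ₑ + ENNReal.ofReal h * ‖F₁ p‖ₑ +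
        ENNReal.ofReal h * (‖F₂ p‖ₑ + ENNReal.ofReal h * ‖F₁₂ p‖ₑ)) := by
  have := hF.measurable
  have := hF₁.measurable
  have := hF₂.measurable
  have := hF₁₂.measurable
  set H := ENNReal.ofReal h
  calc H ^ 2 * ‖F (a, b)‖ₑ = H * (H * ‖F (a, b)‖ₑ) := by ring
    _ ≤ H * ∫⁻ y in Set.Icc b (b + h), (‖F (a, y)‖ₑ + H * ‖F₂ (a, y)‖ₑ) := by
        gcongr
        exact enorm_le_lintegral_deriv (h₂ a) (by fun_prop) _ _
    _ = ∫⁻ y in Set.Icc b (b + h), (H * ‖F (a, y)‖ₑ + H * (H * ‖F₂ (a, y)‖ₑ)) := by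
        rw [← lintegral_const_mul _ (by fun_prop)]
        simp only [mul_add]
    _ ≤ ∫⁻ y in Set.Icc b (b + h), ∫⁻ x in Set.Icc a (a + h),
          (‖F (x, y)‖ₑ + H * ‖F₁ (x, y)‖ₑ + H * (‖F₂ (x, y)‖ₑ + H * ‖F₁₂ (x, y)‖ₑ)) := by
        refine lintegral_mono fun y => ?_
        rw [lintegral_add_left (by fun_prop), lintegral_const_mul _ (by fun_prop)]
        gcongr
        · exact enorm_le_lintegral_deriv (fun x => h₁ x y) (by fun_prop) _ _
        · exact enorm_le_lintegral_deriv (fun x => h₁₂ x y) (by fun_prop) _ _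
    _ = _ := by
        rw [Measure.volume_eq_prod, ← Measure.prod_restrict, lintegral_prod_symm' _ (by fun_prop)]

lemma setLIntegral_square_le {g : ℝ × ℝ → ℝ≥0∞} (hg : Measurable g) (a b h : ℝ) :
    ∫⁻ p in Set.Icc a (a + h) ×ˢ Set.Icc b (b + h), g p ≤
      ENNReal.ofReal h * (∫⁻ p, g p ^ 2) ^ (1 / 2 : ℝ) := by
  set Q := Set.Icc a (a + h) ×ˢ Set.Icc b (b + h)
  have hol := ENNReal.lintegral_mul_le_Lp_mul_Lq (volume.restrict Q)
    Real.HolderConjugate.two_two (f := fun _ => 1) (g := g) aemeasurable_const hg.aemeasurable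
  have hvol : volume Q = ENNReal.ofReal h ^ 2 := by
    rw [Measure.volume_eq_prod, Measure.prod_prod]; simp [sq]
  have hsqrt : (ENNReal.ofReal h ^ 2) ^ (1 / 2 : ℝ) = ENNReal.ofReal h := by
    rw [← ENNReal.rpow_natCast, ← ENNReal.rpow_mul]; norm_num
  simp only [Pi.mul_apply, one_mul, ENNReal.rpow_two, one_pow, lintegral_one,
    Measure.restrict_apply_univ, hvol, hsqrt] at hol
  refine hol.trans ?_
  gcongr
  exact Measure.restrict_le_self

/-! ### Coordinates on the plane -/

/-- The point of the Euclidean plane with given coordinates. -/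
noncomputable def planePoint (p : ℝ × ℝ) : EuclideanSpace ℝ (Fin 2) := !₂[p.1, p.2]

lemma continuous_planePoint : Continuous planePoint := by
  unfold planePoint
  refine (PiLp.continuous_toLp 2 _).comp (continuous_pi fun i => ?_)
  fin_cases i <;> simp <;> fun_prop

lemma hasDerivAt_planePoint_fst (a b : ℝ) :
    HasDerivAt (fun τ => planePoint (τ, b)) (EuclideanSpace.single 0 1) a := by
  have h := ((hasDerivAt_id a).smul_const (EuclideanSpace.single 0 1)).add_const
    (planePoint (0, b))
  rw [one_smul] at h
  refine h.congr_of_eventuallyEq (.of_forall fun τ => ?_)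
  ext i
  fin_cases i <;> simp [planePoint]

lemma hasDerivAt_planePoint_snd (a b : ℝ) :
    HasDerivAt (fun τ => planePoint (a, τ)) (EuclideanSpace.single 1 1) b := by
  have h := ((hasDerivAt_id b).smul_const (EuclideanSpace.single 1 1)).add_const
    (planePoint (a, 0))
  rw [one_smul] at h
  refine h.congr_of_eventuallyEq (.of_forall fun τ => ?_)
  ext i
  fin_cases i <;> simp [planePoint]

lemma l2f_eq (s : ℝ) (φ : Spacetime → ℝ) :
    l2f s φ = (∫⁻ p : ℝ × ℝ, ‖φ (lift s (planePoint p))‖ₑ ^ 2) ^ (1 / 2 : ℝ) := by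
  have h := ((EuclideanSpace.volume_preserving_symm_measurableEquiv_toLp (Fin 2)).symm).comp
    (volume_preserving_finTwoArrow ℝ).symm
  unfold l2f
  congr 1
  exact (h.lintegral_comp_emb (MeasurableEquiv.measurableEmbedding
    ((MeasurableEquiv.finTwoArrow (α := ℝ)).symm.trans
      (MeasurableEquiv.toLp 2 (Fin 2 → ℝ)))) _).symm

lemma norm_planePoint_sub_le {a b h : ℝ} {p : ℝ × ℝ}
    (hp : p ∈ Set.Icc a (a + h) ×ˢ Set.Icc b (b + h)) :
    ‖planePoint p - planePoint (a, b)‖ ≤ 3 / 2 * h := by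
  obtain ⟨⟨h1, h2⟩, h3, h4⟩ := hp
  have hh : 0 ≤ h := by linarith
  refine le_of_sq_le_sq ?_ (by positivity)
  rw [EuclideanSpace.real_norm_sq_eq]
  simp only [planePoint, PiLp.sub_apply, Fin.sum_univ_two, Matrix.cons_val_zero,
    Matrix.cons_val_one]
  nlinarith

/-! ### The weighted inequality -/

lemma weight_le {s : ℝ} (hs : 0 < s) (γ : ℝ) {x₀ x : EuclideanSpace ℝ (Fin 2)}
    (hx : ‖x - x₀‖ ≤ 3 / 8 * (lift s x₀).1) :
    ((lift s x₀).1 - ‖x₀‖) ^ (-γ) ≤ 4 ^ |γ| * ((lift s x).1 - ‖x‖) ^ (-γ) := by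
  have e0 := lift_fst_sq s x₀
  have e := lift_fst_sq s x
  have l0 := norm_lt_lift_fst hs x₀
  have l := norm_lt_lift_fst hs x
  have t1 := lift_fst_le_add hs x x₀
  have t2 := lift_fst_le_add hs x₀ x
  have r1 : ‖x‖ ≤ ‖x₀‖ + ‖x - x₀‖ := norm_le_norm_add_norm_sub' x x₀
  have r2 : ‖x₀‖ ≤ ‖x‖ + ‖x - x₀‖ := norm_le_norm_add_norm_sub x x₀
  rw [norm_sub_rev x₀ x] at t2
  have n0 := norm_nonneg x₀
  have n := norm_nonneg x
  generalize (lift s x₀).1 = t₀ at *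
  generalize (lift s x).1 = t at *
  generalize ‖x₀‖ = r₀ at *
  generalize ‖x‖ = r at *
  have p0 : 0 < t₀ - r₀ := by linarith
  have p : 0 < t - r := by linarith
  -- Both sides equal `s²`, so the ratio of the weights is the inverse ratio of `t + r`, a quantity
  -- that changes by at most `3t₀/4`.
  have e1 : (t - r) * (t + r) = (t₀ - r₀) * (t₀ + r₀) := by nlinarith
  set q := (t - r) / (t₀ - r₀) with hq
  have hq0 : 0 < q := by positivity
  have hqs : q * (t + r) = t₀ + r₀ := by
    rw [hq, div_mul_eq_mul_div, e1]; field_simp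
  have hq4 : q ≤ 4 := by
    by_contra! hc
    nlinarith
  have hq4' : q⁻¹ ≤ 4 := by
    rw [inv_le_comm₀ hq0 (by norm_num)]
    by_contra! hc
    nlinarith
  have hqγ : q ^ γ ≤ 4 ^ |γ| := by
    rcases le_total 0 γ with hγ | hγ
    · rw [abs_of_nonneg hγ]
      exact Real.rpow_le_rpow hq0.le hq4 hγ
    · rw [abs_of_nonpos hγ]
      calc q ^ γ = q⁻¹ ^ (-γ) := by rw [Real.inv_rpow hq0.le, Real.rpow_neg hq0.le, inv_inv]
        _ ≤ 4 ^ (-γ) := Real.rpow_le_rpow (by positivity) hq4' (by linarith)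
  calc (t₀ - r₀) ^ (-γ) = q ^ γ * (t - r) ^ (-γ) := by
        rw [hq, Real.div_rpow p.le p0.le, Real.rpow_neg p.le, Real.rpow_neg p0.le]
        have := (Real.rpow_pos_of_pos p γ).ne'
        field_simp
    _ ≤ _ := by gcongr

/-! ### Multi-indices and the pointwise bound -/

lemma mem_multiIndices_two {i j : ℕ} (h : i + j ≤ 2) : ![i, j] ∈ multiIndices 2 := by
  simp only [multiIndices, Finset.mem_filter, Fintype.mem_piFinset, Finset.mem_range]
  refine ⟨fun k => ?_, by simpa using h⟩
  fin_cases k <;> simp <;> omega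

/-- The multi-indices with both entries at most one. -/
def mixedIndices : Finset (Fin 2 → ℕ) := {![0, 0], ![1, 0], ![0, 1], ![1, 1]}

lemma mixedIndices_subset : mixedIndices ⊆ multiIndices 2 := by
  intro J hJ
  simp only [mixedIndices, Finset.mem_insert, Finset.mem_singleton] at hJ
  rcases hJ with rfl | rfl | rfl | rfl <;> exact mem_multiIndices_two (by norm_num)

lemma sum_mixedIndices {M : Type*} [AddCommMonoid M] (f : (Fin 2 → ℕ) → M) :
    ∑ J ∈ mixedIndices, f J = f ![0, 0] + (f ![1, 0] + (f ![0, 1] + f ![1, 1])) := by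
  unfold mixedIndices
  rw [Finset.sum_insert (by decide), Finset.sum_insert (by decide), Finset.sum_insert (by decide),
    Finset.sum_singleton]

lemma continuous_boostPow {u : Spacetime → ℝ} (hu : ContDiff ℝ 2 u) {J : Fin 2 → ℕ}
    (hJ : J ∈ mixedIndices) : Continuous (boostPow J u) := by
  have h1 (i : Fin 2) : ContDiff ℝ 1 (boost i u) := contDiff_boost hu one_add_one_eq_two.le i
  simp only [mixedIndices, Finset.mem_insert, Finset.mem_singleton] at hJ
  rcases hJ with rfl | rfl | rfl | rfl
  · exact hu.continuous
  · exact (h1 0).continuous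
  · exact (h1 1).continuous
  · exact (contDiff_boost (h1 1) (zero_add 1).le 0).continuous

/-- The constant 16 is `2 · 8`: the scaled derivatives sum to at most twice the four boost terms,
because `h/t ≤ 1/2`, and `t ≤ 2t₀ = 8h`. -/
lemma weighted_integrand_le {s t t₀ h ω ω₀ K x v v₁ v₂ v₁₂ : ℝ} (hs : 0 < s) (ht : 0 < t)
    (hh : 0 < h) (ht₀ : t₀ = 4 * h) (h1 : t ≤ 2 * t₀) (h2 : 2 * h ≤ t) (hω : 0 < ω) (hK : 0 ≤ K)
    (hω₀ : 0 < ω₀) (hle : ω₀ ≤ K * ω) (hx : |x| ≤ t) :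
    s * ω₀ * (|v| + h * |v₁ / t| + h * (|v₂ / t| + h * |(v₁₂ / t * t - v₂ * (x / t)) / t ^ 2|)) ≤
      16 * K * h * (|s / t * ω * v| + (|s / t * ω * v₁| + (|s / t * ω * v₂| +
        |s / t * ω * v₁₂|))) := by
  have hht : h / t ≤ 1 / 2 := by rw [div_le_div_iff₀ ht two_pos]; linarith
  have hht0 : 0 < h / t := by positivity
  have a1 : h * |v₁ / t| = h / t * |v₁| := by rw [abs_div, abs_of_pos ht]; ring
  have a2 : h * |v₂ / t| = h / t * |v₂| := by rw [abs_div, abs_of_pos ht]; ring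
  have a3 : h * (h * |(v₁₂ / t * t - v₂ * (x / t)) / t ^ 2|) ≤ (h / t) ^ 2 * (|v₁₂| + |v₂|) := by
    have hxt : |x / t| ≤ 1 := by
      rw [abs_div, abs_of_pos ht]; exact (div_le_one ht).2 hx
    have : |v₁₂ - v₂ * (x / t)| ≤ |v₁₂| + |v₂| := by
      refine (abs_sub _ _).trans ?_
      rw [abs_mul]
      nlinarith [abs_nonneg v₂]
    rw [div_mul_cancel₀ _ ht.ne', abs_div, abs_of_pos (by positivity : 0 < t ^ 2)]
    calc h * (h * (|v₁₂ - v₂ * (x / t)| / t ^ 2)) = (h / t) ^ 2 * |v₁₂ - v₂ * (x / t)| := by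
          ring
      _ ≤ _ := by gcongr
  have hsq : (h / t) ^ 2 ≤ 1 / 2 := by nlinarith
  have lhs : |v| + h * |v₁ / t| + h * (|v₂ / t| + h * |(v₁₂ / t * t - v₂ * (x / t)) / t ^ 2|) ≤
      2 * (|v| + (|v₁| + (|v₂| + |v₁₂|))) := by
    rw [mul_add, a1, a2]
    nlinarith [abs_nonneg v, abs_nonneg v₁, abs_nonneg v₂, abs_nonneg v₁₂]
  have hc : 0 < s / t * ω := by positivity
  simp only [abs_mul (s / t * ω), abs_of_pos hc, ← mul_add]
  set S := |v| + (|v₁| + (|v₂| + |v₁₂|))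
  have hS : 0 ≤ S := by positivity
  calc _ ≤ s * ω₀ * (2 * S) := by gcongr
    _ ≤ s * (K * ω) * (2 * S) := by gcongr
    _ = 2 * K * t * (s / t * ω * S) := by field_simp
    _ ≤ 2 * K * (8 * h) * (s / t * ω * S) := by gcongr; linarith
    _ = _ := by ring

lemma enorm_lift_le {s : ℝ} (hs : 0 < s) (γ : ℝ) {u : Spacetime → ℝ} (hu : ContDiff ℝ 2 u)
    (q : ℝ × ℝ) :
    ‖s * ((lift s (planePoint q)).1 - ‖(lift s (planePoint q)).2‖) ^ (-γ) *
        u (lift s (planePoint q))‖ₑ ≤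
      ENNReal.ofReal (16 * 4 ^ |γ|) * ∑ J ∈ multiIndices 2, l2f s
        (fun p => s / p.1 * (p.1 - ‖p.2‖) ^ (-γ) * boostPow J u p) := by
  obtain ⟨a, b⟩ := q
  set P : ℝ × ℝ → Spacetime := fun p => lift s (planePoint p) with hP
  have hPc : Continuous P := (continuous_lift s).comp continuous_planePoint
  have hPpos (p) : 0 < (P p).1 := lift_fst_pos hs _
  have hPw (p) : 0 < (P p).1 - ‖(P p).2‖ := sub_pos.2 (norm_lt_lift_fst hs _)
  have hu1 : ContDiff ℝ 1 u := hu.of_le (by norm_num)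
  have hb : ContDiff ℝ 1 (boost 1 u) := contDiff_boost hu one_add_one_eq_two.le 1
  have cb (i : Fin 2) : Continuous (boost i u) :=
    (contDiff_boost hu one_add_one_eq_two.le i).continuous
  have cbb : Continuous (boost 0 (boost 1 u)) :=
    (contDiff_boost hb (zero_add 1).le 0).continuous
  have cu := hu.continuous
  have hc0 : Continuous fun p => planePoint p 0 :=
    (EuclideanSpace.proj (𝕜 := ℝ) (0 : Fin 2)).continuous.comp continuous_planePoint
  -- The square then has diameter `√2 h ≤ 3t₀/8`, the radius allowed in `weight_le`.
  set h := (P (a, b)).1 / 4 with hh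
  have hhpos : 0 < h := by have := hPpos (a, b); positivity
  have key := enorm_le_lintegral_square (F := fun p => u (P p))
    (F₁ := fun p => boost 0 u (P p) / (P p).1) (F₂ := fun p => boost 1 u (P p) / (P p).1)
    -- Quotient rule for `L₂u/t`: besides `L₁L₂u` it leaves a lower-order term in `L₂u`, bounded
    -- because `|x₁| ≤ t`.
    (F₁₂ := fun p => (boost 0 (boost 1 u) (P p) / (P p).1 * (P p).1 -
      boost 1 u (P p) * (planePoint p 0 / (P p).1)) / (P p).1 ^ 2)
    (fun a b => hasDerivAt_comp_lift hs hu1 (hasDerivAt_planePoint_fst a b))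
    (fun a b => hasDerivAt_comp_lift hs hu1 (hasDerivAt_planePoint_snd a b))
    (fun a b => (hasDerivAt_comp_lift hs hb (hasDerivAt_planePoint_fst a b)).div
      (hasDerivAt_lift_fst hs (hasDerivAt_planePoint_fst a b)) (hPpos _).ne')
    (by fun_prop) (by fun_prop (disch := exact fun p => (hPpos p).ne'))
    (by fun_prop (disch := exact fun p => (hPpos p).ne'))
    (by
      have : Continuous fun p => (P p).1 := by fun_prop
      refine Continuous.div ?_ (by fun_prop) (fun p => (pow_pos (hPpos p) 2).ne')
      refine Continuous.sub ?_ ?_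
      · exact ((cbb.comp hPc).div this fun p => (hPpos p).ne').mul this
      · exact ((cb 1).comp hPc).mul (hc0.div this fun p => (hPpos p).ne'))
    a b h
  set G : (Fin 2 → ℕ) → Spacetime → ℝ :=
    fun J p => s / p.1 * (p.1 - ‖p.2‖) ^ (-γ) * boostPow J u p with hG
  set Q := Set.Icc a (a + h) ×ˢ Set.Icc b (b + h) with hQ
  set ω₀ := ((P (a, b)).1 - ‖(P (a, b)).2‖) ^ (-γ) with hω₀
  have hω₀pos : 0 < ω₀ := Real.rpow_pos_of_pos (hPw _) _
  have hmeas (J) (hJ : J ∈ mixedIndices) : Measurable fun p => ‖G J (P p)‖ₑ := by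
    refine Continuous.measurable (Continuous.enorm ?_)
    refine ((continuous_const.div (by fun_prop) fun p => (hPpos p).ne').mul ?_).mul
      ((continuous_boostPow hu hJ).comp hPc)
    exact Continuous.rpow_const (by fun_prop) fun p => Or.inl (hPw p).ne'
  have hpt : ∀ p ∈ Q, ENNReal.ofReal (s * ω₀) * (‖u (P p)‖ₑ +
        ENNReal.ofReal h * ‖boost 0 u (P p) / (P p).1‖ₑ + ENNReal.ofReal h *
        (‖boost 1 u (P p) / (P p).1‖ₑ + ENNReal.ofReal h *
          ‖(boost 0 (boost 1 u) (P p) / (P p).1 * (P p).1 -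
            boost 1 u (P p) * (planePoint p 0 / (P p).1)) / (P p).1 ^ 2‖ₑ)) ≤
      ENNReal.ofReal (16 * 4 ^ |γ| * h) * ∑ J ∈ mixedIndices, ‖G J (P p)‖ₑ := by
    intro p hp
    have hdist : ‖planePoint p - planePoint (a, b)‖ ≤ 3 / 8 * (P (a, b)).1 := by
      have := norm_planePoint_sub_le hp; linarith
    have t1 := lift_fst_le_add hs (planePoint p) (planePoint (a, b))
    have t2 := lift_fst_le_add hs (planePoint (a, b)) (planePoint p)
    rw [norm_sub_rev] at t2
    have hx : |planePoint p 0| ≤ (P p).1 :=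
      (PiLp.norm_apply_le (planePoint p) 0).trans (norm_lt_lift_fst hs _).le
    have hreal := weighted_integrand_le (v := u (P p)) (v₁ := boost 0 u (P p))
      (v₂ := boost 1 u (P p)) (v₁₂ := boost 0 (boost 1 u) (P p)) hs (hPpos p) hhpos
      (t₀ := (P (a, b)).1) (by rw [hh]; ring)
      (by change (P p).1 ≤ (P (a, b)).1 + _ at t1; linarith)
      (by change (P (a, b)).1 ≤ (P p).1 + _ at t2; linarith)
      (Real.rpow_pos_of_pos (hPw p) (-γ)) (by positivity : (0 : ℝ) ≤ 4 ^ |γ|) hω₀pos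
      (weight_le hs γ hdist) hx
    rw [sum_mixedIndices]
    simp only [← ofReal_norm, Real.norm_eq_abs]
    repeat' first
      | rw [← ENNReal.ofReal_mul (by positivity)]
      | rw [← ENNReal.ofReal_add (by positivity) (by positivity)]
    exact ENNReal.ofReal_le_ofReal hreal
  set H := ENNReal.ofReal h with hH
  have hH0 : H ^ 2 ≠ 0 := pow_ne_zero _ (ENNReal.ofReal_pos.2 hhpos).ne'
  have hHt : H ^ 2 ≠ ∞ := ENNReal.pow_ne_top ENNReal.ofReal_ne_top
  have h16 : ENNReal.ofReal (16 * 4 ^ |γ| * h) = ENNReal.ofReal (16 * 4 ^ |γ|) * H :=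
    ENNReal.ofReal_mul (by positivity)
  rw [← ENNReal.mul_le_mul_iff_right hH0 hHt]
  calc H ^ 2 * ‖s * ω₀ * u (P (a, b))‖ₑ
      = ENNReal.ofReal (s * ω₀) * (H ^ 2 * ‖u (P (a, b))‖ₑ) := by
        rw [enorm_mul, Real.enorm_of_nonneg (by positivity : 0 ≤ s * ω₀)]; ring
    _ ≤ ∫⁻ p in Q, ENNReal.ofReal (16 * 4 ^ |γ| * h) * ∑ J ∈ mixedIndices, ‖G J (P p)‖ₑ := by
        refine (mul_le_mul_right key _).trans ?_
        rw [← lintegral_const_mul' _ _ ENNReal.ofReal_ne_top]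
        exact setLIntegral_mono' (measurableSet_Icc.prod measurableSet_Icc) hpt
    _ = ENNReal.ofReal (16 * 4 ^ |γ| * h) * ∑ J ∈ mixedIndices, ∫⁻ p in Q, ‖G J (P p)‖ₑ := by
        rw [lintegral_const_mul' _ _ ENNReal.ofReal_ne_top, lintegral_finsetSum' _
          fun J hJ => (hmeas J hJ).aemeasurable]
    _ ≤ ENNReal.ofReal (16 * 4 ^ |γ| * h) * ∑ J ∈ mixedIndices, H * l2f s (G J) := by
        gcongr with J hJ
        rw [l2f_eq]
        exact setLIntegral_square_le (hmeas J hJ) a b h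
    _ ≤ ENNReal.ofReal (16 * 4 ^ |γ| * h) * ∑ J ∈ multiIndices 2, H * l2f s (G J) := by
        gcongr
        exact mixedIndices_subset
    _ = _ := by rw [← Finset.mul_sum, h16]; ring

/-- The weighted Klainerman–Sobolev inequality on the hyperboloid `H_s`. -/
lemma iSup_hyperboloid_le {s : ℝ} (hs : 0 < s) (γ : ℝ) {u : Spacetime → ℝ} (hu : ContDiff ℝ 2 u)
    (hsupp : Function.support u ⊆ cone) :
    (⨆ p ∈ hyperboloid s, ‖s * (p.1 - ‖p.2‖) ^ (-γ) * u p‖ₑ) ≤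
      ENNReal.ofReal (16 * 4 ^ |γ|) * ∑ J ∈ multiIndices 2, l2f s
        (fun p => s / p.1 * (p.1 - ‖p.2‖) ^ (-γ) * boostPow J u p) := by
  refine iSup₂_le fun p hp => ?_
  by_cases hup : u p = 0
  · simp [hup]
  -- The cone forces `t > 0`, so `p` lies on the upper sheet, the image of `lift`.
  have hcone : ‖p.2‖ ≤ p.1 - 1 := hsupp hup
  have hlift : lift s (planePoint (p.2 0, p.2 1)) = p := by
    have h2 : planePoint (p.2 0, p.2 1) = p.2 := by
      ext i; fin_cases i <;> rfl
    rw [h2]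
    refine Prod.ext ?_ rfl
    change √(s ^ 2 + ‖p.2‖ ^ 2) = p.1
    rw [add_comm, ← show p.1 ^ 2 = ‖p.2‖ ^ 2 + s ^ 2 from hp]
    exact Real.sqrt_sq (by linarith [norm_nonneg p.2])
  have := enorm_lift_le hs γ hu (p.2 0, p.2 1)
  rwa [hlift] at this

end Spacetime

theorem lemma3p4 :
    (∃ C : ℝ≥0, ∀ s : ℝ, 2 ≤ s → ∀ u : Spacetime → ℝ, ContDiff ℝ 2 u →
      Function.support u ⊆ Spacetime.cone →
      (⨆ p ∈ Spacetime.hyperboloid s, ‖s * u p‖ₑ) ≤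
        C * ∑ J ∈ Spacetime.multiIndices 2,
          Spacetime.l2f s (fun p => s / p.1 * Spacetime.boostPow J u p)) ∧
    (∀ γ : ℝ, ∃ C : ℝ≥0, ∀ s : ℝ, 2 ≤ s → ∀ u : Spacetime → ℝ, ContDiff ℝ 2 u →
      Function.support u ⊆ Spacetime.cone →
      (⨆ p ∈ Spacetime.hyperboloid s, ‖s * (p.1 - ‖p.2‖) ^ (-γ) * u p‖ₑ) ≤
        C * ∑ J ∈ Spacetime.multiIndices 2,
          Spacetime.l2f s
            (fun p => s / p.1 * (p.1 - ‖p.2‖) ^ (-γ) * Spacetime.boostPow J u p)) := by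
  refine ⟨⟨Real.toNNReal (16 * 4 ^ |(0 : ℝ)|), fun s hs u hu hsupp => ?_⟩,
    fun γ => ⟨Real.toNNReal (16 * 4 ^ |γ|), fun s hs u hu hsupp =>
      Spacetime.iSup_hyperboloid_le (by linarith) γ hu hsupp⟩⟩
  have h := Spacetime.iSup_hyperboloid_le (by linarith : 0 < s) 0 hu hsupp
  simp only [neg_zero, Real.rpow_zero, mul_one] at h
  exact h
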